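/- Let $U=[0,1]^2$ be the closed unit square. Let $(\gamma_i)_{i\in I}$ be a finite or countably infinite family of rectifiable curves in the plane with finite total length $\sum_{i\in I}|\gamma_i|<\infty$, and let $\Gamma=\bigcup_{i\in I}\gamma_i$ be their union. Suppose that $\Gamma$ is a barrier for $U$, that is, $\Gamma$ meets every straight line that intersects $U$, and that it is an interior barrier, that is, $\Gamma\subseteq U$. Then the length of the barrier satisfies $$\sum_{i\in I}|\gamma_i|\ \ge\ 2+10^{-5}.$$ -/

import Mathlib

open scoped ENNReal unitInterval

/-- The Euclidean plane. -/
abbrev Plane : Type := EuclideanSpace ℝ (Fin 2)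

/-- The closed unit square `[0,1]²`. -/
def unitSquare : Set Plane := {x | ∀ i, x i ∈ Set.Icc (0 : ℝ) 1}

/-- The full straight line through `p` in direction `v` (a line when `v ≠ 0`). -/
def lineThrough (p v : Plane) : Set Plane := {x | ∃ t : ℝ, x = p + t • v}

/-- `Γ` is a barrier (opaque set) for `C`: it meets every line that meets `C`. -/
def IsBarrier (C Γ : Set Plane) : Prop :=
  ∀ p v : Plane, v ≠ 0 →
    (lineThrough p v ∩ C).Nonempty → (lineThrough p v ∩ Γ).Nonempty

/-- The length of a parametrized planar curve: the supremum of the lengths of inscribed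
polygonal paths. -/
noncomputable def curveLength (γ : C(I, Plane)) : ℝ≥0∞ := eVariationOn γ Set.univ

/-- The total length of a family of curves. -/
noncomputable def totalLength {ι : Type*} (γ : ι → C(I, Plane)) : ℝ≥0∞ :=
  ∑' i, curveLength (γ i)

/-- The set of points covered by a family of curves. -/
def curveUnion {ι : Type*} (γ : ι → C(I, Plane)) : Set Plane := ⋃ i, Set.range (γ i)

/-- A countable family of rectifiable curves of finite total length, whose union is a barrier
for `C`. -/
structure IsRectifiableBarrier {ι : Type*} (C : Set Plane) (γ : ι → C(I, Plane)) : Prop where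
  countable : Countable ι
  rectifiable : ∀ i, curveLength (γ i) < ∞
  totalLength_lt_top : totalLength γ < ∞
  isBarrier : IsBarrier C (curveUnion γ)

/-- A rectifiable barrier for `C` all of whose curves lie in `C`. -/
structure IsInteriorBarrier {ι : Type*} (C : Set Plane) (γ : ι → C(I, Plane)) : Prop
    extends IsRectifiableBarrier C γ where
  subset : curveUnion γ ⊆ C

/-!
Each direction of lines already gives the bound 2 up to a defect: the projection of a barrier covers
that of the square, and summing this over the slopes `±l`, `±1/l` shows that a barrier of length
`2 + δ` has, for every slope `l ∈ [1/2, 2]`, a projection whose total length, counted with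
multiplicity, exceeds that of the square by `O(δ)` (`IsSquareBarrierParam.lintegral_le`). So almost
every line of such a slope meets the barrier only once. This is contradicted by two parts `A` and
`B` of the barrier of definite length, near opposite corners of the square, all of whose connecting
lines have slopes in `[3/5, 5/3]`.

The obstacle is that the pairs in `A × B` might all be connected by few lines of high multiplicity.
Fix `ω ∈ A` and rotate a line about it. The points of `B` cross this line at bounded speed, since
the barrier lies in the square; so whenever a mass of `B` crosses in a short range of slopes, all of
that mass is in a narrow strip beside `ω` at the start of this range. Hence either the strip is
*crowded*, carrying more than twice its width, or the crossing mass is at most a constant times the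
length of the range. A rising-sun argument (`min_le_mul_volume_of_measure_Ico_le`) turns this into a
lower bound, proportional to the length of `B`, for the measure of the slopes at which the line
through `ω` meets `B` or is crowded (`IsSquareBarrierParam.le_volume_slice_badPairs`). On the other
hand, for every fixed slope these `ω` have length `O(δ)`: those on lines that meet `B` because they
are redundant, the crowded ones by a maximal inequality (`measure_setOf_dense_interval_le`).
Integrating over slopes and points in both orders gives the contradiction.

Arc-length parametrizations (`exists_arclength_param`) and the area inequality for Lipschitz
functions make the projections measurable quantities on the disjoint union of the parameter
intervals.
-/

open MeasureTheory Set Filter Topology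

/-! ### Rectifiable curves and Lipschitz functions on the line -/

/-- Parametrization by arc length: a continuous path of finite length `ℓ` has the same image as a
1-Lipschitz path on `[0, ℓ]`. The variation function of a continuous path is continuous, so it maps
`[0, 1]` onto `[0, ℓ]`, and any right inverse of it serves as the change of parameter. -/
theorem exists_lipschitzWith_image_eq {E : Type*} [MetricSpace E] {f : ℝ → E}
    (hf : Continuous f) (hfin : eVariationOn f (Icc 0 1) ≠ ∞) :
    ∃ c : ℝ → E, LipschitzWith 1 c ∧
      c '' Icc 0 (eVariationOn f (Icc 0 1)).toReal = f '' Icc 0 1 := by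
  set s : Set ℝ := Icc 0 1 with hs
  have hb : BoundedVariationOn f s := hfin
  have hfin' : ∀ a b, eVariationOn f (s ∩ Icc a b) ≠ ∞ := fun a b =>
    ne_top_of_le_ne_top hfin (eVariationOn.mono f inter_subset_left)
  set v : ℝ → ℝ := fun t => (eVariationOn f (s ∩ Icc 0 t)).toReal with hv
  have hadd : ∀ x ∈ s, ∀ y ∈ s, x ≤ y →
      v y = v x + (eVariationOn f (s ∩ Icc x y)).toReal := by
    intro x hx y hy hxy
    rw [hv]
    dsimp only
    rw [← eVariationOn.Icc_add_Icc f hx.1 hxy hx, ENNReal.toReal_add (hfin' _ _) (hfin' _ _)]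
  have hdist : ∀ x ∈ s, ∀ y ∈ s, dist (f x) (f y) ≤ |v x - v y| := by
    have key : ∀ x ∈ s, ∀ y ∈ s, x ≤ y → dist (f x) (f y) ≤ |v x - v y| := by
      intro x hx y hy hxy
      have h1 := hadd x hx y hy hxy
      have h2 : edist (f x) (f y) ≤ eVariationOn f (s ∩ Icc x y) :=
        eVariationOn.edist_le f ⟨hx, le_rfl, hxy⟩ ⟨hy, hxy, le_rfl⟩
      rw [abs_sub_comm, h1, add_sub_cancel_left, abs_of_nonneg ENNReal.toReal_nonneg, dist_edist]
      exact ENNReal.toReal_mono (hfin' _ _) h2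
    intro x hx y hy
    rcases le_total x y with h | h
    · exact key x hx y hy h
    · rw [dist_comm, abs_sub_comm]; exact key y hy x hx h
  have hcont : ContinuousOn v s := by
    intro x hx
    have h1 := hb.tendsto_eVariationOn_Icc_zero_left (x := x) hf.continuousWithinAt
    have h2 := hb.tendsto_eVariationOn_Icc_zero_right x hf.continuousWithinAt
    have h1' := (ENNReal.tendsto_toReal ENNReal.zero_ne_top).comp h1
    have h2' := (ENNReal.tendsto_toReal ENNReal.zero_ne_top).comp h2
    have h3 := h1'.add h2'
    rw [ENNReal.toReal_zero, add_zero] at h3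
    rw [ContinuousWithinAt, tendsto_iff_dist_tendsto_zero]
    refine squeeze_zero' (Eventually.of_forall fun _ => dist_nonneg) ?_ h3
    filter_upwards [self_mem_nhdsWithin] with y hy
    simp only [Function.comp]
    rw [Real.dist_eq]
    rcases le_total x y with h | h
    · rw [hadd x hx y hy h, add_sub_cancel_left, abs_of_nonneg ENNReal.toReal_nonneg]
      exact le_add_of_nonneg_left ENNReal.toReal_nonneg
    · rw [hadd y hy x hx h, abs_sub_comm, add_sub_cancel_left, abs_of_nonneg ENNReal.toReal_nonneg]
      exact le_add_of_nonneg_right ENNReal.toReal_nonneg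
  have h0 : v 0 = 0 := by
    simp only [hv, Icc_self]
    rw [eVariationOn.subsingleton f (subsingleton_singleton.anti inter_subset_right)]
    rfl
  have hv1 : v 1 = (eVariationOn f s).toReal := by simp only [hv]; rw [← hs, inter_self]
  set ℓ := (eVariationOn f s).toReal with hℓ
  have hℓ0 : 0 ≤ ℓ := ENNReal.toReal_nonneg
  have hsurj : ∀ r ∈ Icc 0 ℓ, ∃ t ∈ s, v t = r := by
    intro r hr
    have := intermediate_value_Icc (zero_le_one) hcont
    rw [h0, hv1] at this
    exact this hr
  choose! φ hφs hφ using hsurj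
  have hvmem : ∀ t ∈ s, v t ∈ Icc 0 ℓ := by
    intro t ht
    refine ⟨ENNReal.toReal_nonneg, ?_⟩
    exact ENNReal.toReal_mono hfin (eVariationOn.mono f inter_subset_left)
  have hfφ : ∀ t ∈ s, f (φ (v t)) = f t := by
    intro t ht
    have := hdist _ (hφs _ (hvmem t ht)) t ht
    rw [hφ _ (hvmem t ht), sub_self, abs_zero] at this
    exact dist_le_zero.1 this
  refine ⟨fun r => f (φ (projIcc 0 ℓ hℓ0 r)), ?_, ?_⟩
  · refine LipschitzWith.of_dist_le_mul fun a b => ?_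
    have ha := (projIcc 0 ℓ hℓ0 a).2
    have hb := (projIcc 0 ℓ hℓ0 b).2
    have := hdist _ (hφs _ ha) _ (hφs _ hb)
    rw [hφ _ ha, hφ _ hb] at this
    refine this.trans ?_
    have h4 := (LipschitzWith.projIcc hℓ0).dist_le_mul a b
    rwa [Subtype.dist_eq, Real.dist_eq] at h4
  · ext p
    constructor
    · rintro ⟨r, hr, rfl⟩
      exact ⟨_, hφs _ (projIcc 0 ℓ hℓ0 r).2, rfl⟩
    · rintro ⟨t, ht, rfl⟩
      refine ⟨v t, hvmem t ht, ?_⟩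
      dsimp only
      rw [projIcc_of_mem hℓ0 (hvmem t ht)]
      exact hfφ t ht

theorem exists_arclength_param (γ : C(I, Plane)) (h : curveLength γ < ∞) :
    ∃ c : ℝ → Plane, LipschitzWith 1 c ∧
      c '' Icc 0 (curveLength γ).toReal = range γ := by
  set f : ℝ → Plane := fun t => γ (projIcc 0 1 zero_le_one t) with hf
  have hfc : Continuous f := γ.continuous.comp continuous_projIcc
  have hv : eVariationOn f (Icc 0 1) = curveLength γ := by
    have h1 := eVariationOn.comp_eq_of_monotoneOn (γ : I → Plane) (t := Icc (0 : ℝ) 1)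
      (projIcc (0 : ℝ) 1 zero_le_one) ((monotone_projIcc _).monotoneOn _)
    have h2 : projIcc (0 : ℝ) 1 zero_le_one '' Icc 0 1 = univ := by
      refine eq_univ_of_forall fun x => ⟨x, x.2, projIcc_val _ _⟩
    rw [h2] at h1
    exact h1
  obtain ⟨c, hc, him⟩ := exists_lipschitzWith_image_eq hfc (by rw [hv]; exact h.ne)
  refine ⟨c, hc, ?_⟩
  rw [hv] at him
  rw [him]
  ext p
  constructor
  · rintro ⟨t, -, rfl⟩; exact ⟨_, rfl⟩
  · rintro ⟨t, rfl⟩; exact ⟨t, t.2, by simp [hf]⟩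

/-- A Lipschitz function is differentiable off a null set, whose image is again null; on the set of
differentiability the area inequality applies. -/
theorem volume_image_le_lintegral_abs_deriv {f : ℝ → ℝ} {K : NNReal} (hf : LipschitzWith K f)
    {s : Set ℝ} (hs : MeasurableSet s) :
    volume (f '' s) ≤ ∫⁻ t in s, ENNReal.ofReal |deriv f t| := by
  set T : Set ℝ := {t | DifferentiableAt ℝ f t}
  have hT : MeasurableSet T := measurableSet_of_differentiableAt ℝ f
  have hnull : volume Tᶜ = 0 := hf.ae_differentiableAt_real
  have h1 : volume (f '' (s ∩ T)) ≤ ∫⁻ t in s ∩ T, ENNReal.ofReal |deriv f t| := by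
    have := addHaar_image_le_lintegral_abs_det_fderiv volume (hs.inter hT) (f := f)
      (f' := fun t => ContinuousLinearMap.toSpanSingleton ℝ (deriv f t))
      (fun t ht => (ht.2.hasDerivAt.hasFDerivAt).hasFDerivWithinAt)
    simpa using this
  have h2 : volume (f '' (s ∩ Tᶜ)) = 0 := by
    have h3 := hf.hausdorffMeasure_image_le (d := 1) zero_le_one (s ∩ Tᶜ)
    rw [hausdorffMeasure_real, measure_mono_null inter_subset_right hnull, mul_zero] at h3
    exact le_antisymm h3 zero_le
  calc volume (f '' s) ≤ volume (f '' (s ∩ T) ∪ f '' (s ∩ Tᶜ)) := by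
        refine measure_mono ?_
        rw [← image_union, inter_union_compl]
    _ ≤ volume (f '' (s ∩ T)) + volume (f '' (s ∩ Tᶜ)) := measure_union_le _ _
    _ ≤ ∫⁻ t in s ∩ T, ENNReal.ofReal |deriv f t| := by rw [h2, add_zero]; exact h1
    _ ≤ _ := lintegral_mono_set inter_subset_left

/-! ### Two covering estimates on the line -/

/-- A one-sided maximal inequality. If the measure `ν` exceeds Lebesgue measure by at most `W` on
every set, then the points at which some interval to the right carries more than twice its length
have `ν`-measure at most `5 * W`. -/
theorem measure_setOf_dense_interval_le {ν : Measure ℝ} [IsFiniteMeasure ν] {W : ℝ≥0∞}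
    (hW : ∀ Y, MeasurableSet Y → ν Y ≤ volume Y + W) :
    ν {t | ∃ r : ℝ, 0 < r ∧ ENNReal.ofReal (2 * r) < ν (Icc t (t + r))} ≤ 5 * W := by
  set T : Set (ℝ × ℝ) := {p | 0 < p.2 ∧ ENNReal.ofReal (4 * p.2) < ν (Metric.closedBall p.1 p.2)}
    with hT
  have hR : ∀ p ∈ T, p.2 ≤ (ν univ).toReal := by
    intro p hp
    have h1 : ENNReal.ofReal (4 * p.2) ≤ ν univ := hp.2.le.trans (measure_mono (subset_univ _))
    have h2 := (ENNReal.ofReal_le_iff_le_toReal (measure_ne_top ν univ)).1 h1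
    linarith [hp.1]
  obtain ⟨u, huT, hdisj, hcov⟩ := Vitali.exists_disjoint_subfamily_covering_enlargement_closedBall
    T (fun p => p.1) (fun p => p.2) _ hR 4 (by norm_num)
  have hcount : u.Countable := by
    refine hdisj.countable_of_nonempty_interior fun p hp => ?_
    rw [interior_closedBall _ (huT hp).1.ne']
    exact Metric.nonempty_ball.2 (huT hp).1
  set V : Set ℝ := ⋃ p ∈ u, Metric.closedBall p.1 p.2 with hV
  have hVm : MeasurableSet V := .biUnion hcount fun _ _ => measurableSet_closedBall
  have hvol : volume V = ∑' p : u, ENNReal.ofReal (2 * (p : ℝ × ℝ).2) := by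
    rw [hV, measure_biUnion hcount hdisj fun _ _ => measurableSet_closedBall]
    simp only [Real.volume_closedBall]
  have hν : 2 * volume V ≤ ν V := by
    rw [hvol, hV, measure_biUnion hcount hdisj fun _ _ => measurableSet_closedBall,
      ← ENNReal.tsum_mul_left]
    refine ENNReal.tsum_le_tsum fun p => ?_
    refine le_trans (le_of_eq ?_) (huT p.2).2.le
    rw [← ENNReal.ofReal_ofNat 2, ← ENNReal.ofReal_mul (by norm_num)]
    congr 1; ring
  have hfin : volume V ≠ ∞ := by
    intro h
    rw [h] at hν
    exact measure_ne_top ν V (top_le_iff.1 (by simp at hν))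
  -- The selected intervals carry at least twice their length but at most their length plus `W`.
  have hVW : volume V ≤ W := by
    have h1 := hν.trans (hW V hVm)
    rw [two_mul] at h1
    exact (ENNReal.add_le_add_iff_left hfin).1 h1
  set V' : Set ℝ := ⋃ p ∈ u, Metric.closedBall p.1 (4 * p.2) with hV'
  have hV'm : MeasurableSet V' := .biUnion hcount fun _ _ => measurableSet_closedBall
  have hvol' : volume V' ≤ 4 * volume V := by
    refine (measure_biUnion_le volume hcount _).trans ?_
    rw [hvol, ← ENNReal.tsum_mul_left]
    refine ENNReal.tsum_le_tsum fun p => ?_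
    rw [Real.volume_closedBall, ← ENNReal.ofReal_ofNat 4, ← ENNReal.ofReal_mul (by norm_num)]
    apply le_of_eq; congr 1; ring
  calc ν {t | ∃ r : ℝ, 0 < r ∧ ENNReal.ofReal (2 * r) < ν (Icc t (t + r))} ≤ ν V' := by
        refine measure_mono ?_
        rintro t ⟨r, hr, hlt⟩
        have hb : Metric.closedBall (t + r / 2) (r / 2) = Icc t (t + r) := by
          rw [Real.closedBall_eq_Icc]; congr 1 <;> ring
        have hmem : ((t + r / 2, r / 2) : ℝ × ℝ) ∈ T := by
          refine ⟨half_pos hr, ?_⟩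
          dsimp only
          rw [hb]
          convert hlt using 2
          ring
        obtain ⟨b, hbu, hsub⟩ := hcov _ hmem
        refine mem_biUnion hbu (hsub ?_)
        dsimp only
        rw [hb]
        exact ⟨le_rfl, by linarith⟩
    _ ≤ volume V' + W := hW _ hV'm
    _ ≤ 4 * W + W := by
        gcongr
        exact hvol'.trans (by gcongr)
    _ = 5 * W := by rw [show (5 : ℝ≥0∞) = 4 + 1 by norm_num, add_mul, one_mul]

/-- A rising-sun estimate. Suppose that `μ` lives on `E` and that every interval starting at a point
outside `E` has `μ`-measure at most `Λ` times its length. In an open set `G ⊇ E` every component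
starts at a point outside `E`, so that `μ univ = μ G ≤ Λ * volume G`. The hypothesis is available
only for starting points to the right of `p`, while `μ` vanishes to the left of `q`: a component
that starts before `p` and meets `[q, ∞)` has length at least `q - p`, whence the minimum. -/
theorem min_le_mul_volume_of_measure_Ico_le {μ : Measure ℝ} [IsFiniteMeasure μ] {E : Set ℝ}
    {p q Λ : ℝ} (hΛ : 0 < Λ) (hE : μ Eᶜ = 0) (hq : μ (Iio q) = 0)
    (h : ∀ a, p ≤ a → a ∉ E → ∀ ℓ, 0 < ℓ → μ (Ico a (a + ℓ)) ≤ ENNReal.ofReal (Λ * ℓ)) :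
    min (ENNReal.ofReal (Λ * (q - p))) (μ univ) ≤ ENNReal.ofReal Λ * volume E := by
  by_contra! hlt
  have hΛ0 : ENNReal.ofReal Λ ≠ 0 := by simpa using hΛ
  set m := min (ENNReal.ofReal (Λ * (q - p))) (μ univ) with hm
  have hlt' : volume E < m / ENNReal.ofReal Λ := by
    rwa [ENNReal.lt_div_iff_mul_lt (Or.inl hΛ0) (Or.inl ENNReal.ofReal_ne_top), mul_comm]
  obtain ⟨G, hEG, hGo, hGm⟩ := E.exists_isOpen_lt_of_lt _ hlt'
  rw [ENNReal.lt_div_iff_mul_lt (Or.inl hΛ0) (Or.inl ENNReal.ofReal_ne_top), mul_comm] at hGm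
  have hGtop : volume G ≠ ∞ := by
    intro h'
    rw [h', ENNReal.mul_top hΛ0] at hGm
    exact not_top_lt hGm
  have hcomp : ∀ x ∈ G, μ (connectedComponentIn G x) ≤
      ENNReal.ofReal Λ * volume (connectedComponentIn G x) := by
    intro x hx
    set C := connectedComponentIn G x with hC
    have hxC : x ∈ C := mem_connectedComponentIn hx
    have hCo : IsOpen C := hGo.connectedComponentIn
    have hCc : IsPreconnected C := isPreconnected_connectedComponentIn
    have hCG : C ⊆ G := connectedComponentIn_subset G x
    have hord : C.OrdConnected := hCc.ordConnected
    have hCtop : volume C ≠ ∞ := ne_top_of_le_ne_top hGtop (measure_mono hCG)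
    by_cases hp : ∃ y ∈ C, y ≤ p
    · obtain ⟨y, hyC, hyp⟩ := hp
      have : C ⊆ Iio q := by
        intro z hz
        by_contra! hzq
        rw [mem_Iio, not_lt] at hzq
        have h1 : Icc p q ⊆ G := fun w hw =>
          hCG (hord.out hyC hz ⟨hyp.trans hw.1, hw.2.trans hzq⟩)
        have h2 := measure_mono (μ := volume) h1
        rw [Real.volume_Icc] at h2
        have h3 : ENNReal.ofReal (Λ * (q - p)) ≤ ENNReal.ofReal Λ * volume G := by
          rw [ENNReal.ofReal_mul hΛ.le]; gcongr
        exact absurd (hGm.trans_le (min_le_left _ _)) (not_lt.2 h3)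
      rw [measure_mono_null this hq]
      exact zero_le
    · push Not at hp
      have hbdd : BddBelow C := ⟨p, fun z hz => (hp z hz).le⟩
      set a := sInf C with ha
      have hpa : p ≤ a := le_csInf ⟨x, hxC⟩ fun z hz => (hp z hz).le
      -- Otherwise the component could be extended to `a`, and, being open, beyond it.
      have haG : a ∉ G := by
        intro haG
        have h1 : insert a C ⊆ C := by
          have : IsPreconnected (insert a C) :=
            hCc.subset_closure (subset_insert _ _)
              (insert_subset (csInf_mem_closure ⟨x, hxC⟩ hbdd) subset_closure)
          exact this.subset_connectedComponentIn (mem_insert_of_mem _ hxC)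
            (insert_subset haG hCG)
        obtain ⟨l, r, hlr, hsub⟩ :=
          mem_nhds_iff_exists_Ioo_subset.1 (hCo.mem_nhds (h1 (mem_insert _ _)))
        obtain ⟨w, hw1, hw2⟩ := exists_between hlr.1
        exact absurd (csInf_le hbdd (hsub ⟨hw1, hw2.trans hlr.2⟩)) (not_le.2 hw2)
      have hlen : ∀ z ∈ C, z - a ≤ (volume C).toReal := by
        intro z hz
        have h1 : Ioc a z ⊆ C := by
          intro w hw
          obtain ⟨y, hy, hyw⟩ := exists_lt_of_csInf_lt ⟨x, hxC⟩ hw.1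
          exact hord.out hy hz ⟨hyw.le, hw.2⟩
        have h2 := measure_mono (μ := volume) h1
        rw [Real.volume_Ioc] at h2
        exact (ENNReal.ofReal_le_iff_le_toReal hCtop).1 h2
      have hCsub : C ⊆ Ico a (a + (volume C).toReal) := by
        intro z hz
        refine ⟨csInf_le hbdd hz, ?_⟩
        obtain ⟨l, r, hlr, hsub⟩ := mem_nhds_iff_exists_Ioo_subset.1 (hCo.mem_nhds hz)
        obtain ⟨w, hw1, hw2⟩ := exists_between hlr.2
        linarith [hlen w (hsub ⟨hlr.1.trans hw1, hw2⟩)]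
      have hpos : 0 < (volume C).toReal :=
        ENNReal.toReal_pos (hCo.measure_pos volume ⟨x, hxC⟩).ne' hCtop
      calc μ C ≤ _ := measure_mono hCsub
        _ ≤ _ := h a hpa (fun haE => haG (hEG haE)) _ hpos
        _ = _ := by rw [ENNReal.ofReal_mul hΛ.le, ENNReal.ofReal_toReal hCtop]
  set Q : Set (Set ℝ) := connectedComponentIn G '' G with hQ
  have hdisj : Q.PairwiseDisjoint id := by
    rintro _ ⟨x, hx, rfl⟩ _ ⟨y, hy, rfl⟩ hne
    by_contra hnd
    obtain ⟨z, hzx, hzy⟩ := not_disjoint_iff.1 hnd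
    exact hne ((connectedComponentIn_eq hzx).trans (connectedComponentIn_eq hzy).symm)
  have hopen : ∀ C ∈ Q, IsOpen C := by
    rintro _ ⟨x, hx, rfl⟩; exact hGo.connectedComponentIn
  have hcount : Q.Countable := hdisj.countable_of_isOpen hopen
    (by rintro _ ⟨x, hx, rfl⟩; exact ⟨x, mem_connectedComponentIn hx⟩)
  have hGU : G = ⋃ C ∈ Q, C := by
    ext x
    simp only [mem_iUnion]
    constructor
    · exact fun hx => ⟨_, ⟨x, hx, rfl⟩, mem_connectedComponentIn hx⟩
    · rintro ⟨_, ⟨y, hy, rfl⟩, hxy⟩; exact connectedComponentIn_subset _ _ hxy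
  have h1 : μ univ ≤ ENNReal.ofReal Λ * volume G := by
    have hGc : μ Gᶜ = 0 := measure_mono_null (compl_subset_compl.2 hEG) hE
    calc μ univ ≤ μ G + μ Gᶜ := by rw [← union_compl_self G]; exact measure_union_le _ _
      _ = μ (⋃ C ∈ Q, C) := by rw [hGc, add_zero, ← hGU]
      _ ≤ ∑' C : Q, μ C := measure_biUnion_le μ hcount _
      _ ≤ ∑' C : Q, ENNReal.ofReal Λ * volume (C : Set ℝ) := by
          refine ENNReal.tsum_le_tsum fun C => ?_
          obtain ⟨_, x, hx, rfl⟩ := C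
          exact hcomp x hx
      _ = ENNReal.ofReal Λ * volume G := by
          rw [ENNReal.tsum_mul_left]
          congr 1
          conv_rhs => rw [hGU]
          exact (measure_biUnion hcount hdisj fun C hC => (hopen C hC).measurableSet).symm
  exact absurd (hGm.trans_le (min_le_right _ _)) (not_lt.2 h1)

/-! ### Projections of a short barrier -/

/-- Parametrization of an interior barrier for the unit square by a measure space: the parameters in
the closed set `S`, of full measure, describe the points `(x ω, y ω)` of the barrier, `μ` is arc
length and `(u ω, v ω)` is the velocity at `ω`, of norm at most one. The field `exists_eq` says that
every line through the square meets the barrier, and `volume_image_le` bounds the projections of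
pieces of the barrier by the integral of the velocity. -/
structure IsSquareBarrierParam {Ω : Type*} [TopologicalSpace Ω] [MeasurableSpace Ω]
    (μ : Measure Ω) (S : Set Ω) (x y u v : Ω → ℝ) : Prop where
  isClosed : IsClosed S
  null : μ Sᶜ = 0
  continuous_x : Continuous x
  continuous_y : Continuous y
  measurable_u : Measurable u
  measurable_v : Measurable v
  speed_le : ∀ ω, u ω ^ 2 + v ω ^ 2 ≤ 1
  x_mem : ∀ ω ∈ S, x ω ∈ Icc (0 : ℝ) 1
  y_mem : ∀ ω ∈ S, y ω ∈ Icc (0 : ℝ) 1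
  exists_eq : ∀ a b p q : ℝ, (a ≠ 0 ∨ b ≠ 0) → p ∈ Icc (0 : ℝ) 1 → q ∈ Icc (0 : ℝ) 1 →
    ∃ ω ∈ S, a * x ω + b * y ω = a * p + b * q
  volume_image_le : ∀ (a b : ℝ) (T : Set Ω), MeasurableSet T →
    volume ((fun ω => a * x ω + b * y ω) '' (S ∩ T)) ≤
      ∫⁻ ω in T, ENNReal.ofReal |a * u ω + b * v ω| ∂μ

theorem abs_add_add_abs_sub_le (u v : ℝ) :
    |1 * u + 1 * v| + |-1 * u + 1 * v| ≤ 2 * max |u| |v| := by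
  rcases le_total 0 (1 * u + 1 * v) with h3 | h3 <;>
  rcases le_total 0 (-1 * u + 1 * v) with h4 | h4 <;>
  simp only [abs_of_nonneg, abs_of_nonpos, h3, h4] <;>
  linarith [le_max_left |u| |v|, le_max_right |u| |v|, le_abs_self u, neg_abs_le u,
    le_abs_self v, neg_abs_le v]

/-- The sum of the projections of a vector of norm at most one to the normals of the lines of slopes
`±l` and `±1/l`, scaled. The bound, which is attained on the coordinate axes, is the sum of the
corresponding widths of the unit square divided by two. -/
theorem sum_abs_le_of_speed_le {u v l : ℝ} (h : u ^ 2 + v ^ 2 ≤ 1) (hl : l ∈ Icc (1 / 2 : ℝ) 2) :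
    |-l * u + 1 * v| + |l * u + 1 * v| + |1 * u + l * v| + |-1 * u + l * v| ≤ 2 * (1 + l) := by
  obtain ⟨h1, h2⟩ := hl
  have hu : |u| ≤ 1 := abs_le_one_iff_mul_self_le_one.2 (by nlinarith [sq_nonneg v])
  have hv : |v| ≤ 1 := abs_le_one_iff_mul_self_le_one.2 (by nlinarith [sq_nonneg u])
  have hs : |u| + |v| ≤ 3 / 2 := by
    nlinarith [sq_abs u, sq_abs v, sq_nonneg (|u| - |v|)]
  have hs' : (|u| + |v|) ^ 2 ≤ 2 := by
    nlinarith [sq_abs u, sq_abs v, sq_nonneg (|u| - |v|)]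
  have hl2 : l * (|u| + |v|) ≤ 1 + l := by
    nlinarith [sq_nonneg (|u| + |v| - 1), abs_nonneg u, abs_nonneg v]
  have e1 : |-l * u + 1 * v| + |l * u + 1 * v| ≤ 2 * max (|v|) (l * |u|) := by
    have := abs_add_add_abs_sub_le (l * u) v
    rw [abs_mul, abs_of_nonneg (by linarith : 0 ≤ l), max_comm] at this
    rw [add_comm |-l * u + 1 * v|]
    convert this using 3 <;> ring_nf
  have e2 : |1 * u + l * v| + |-1 * u + l * v| ≤ 2 * max (|u|) (l * |v|) := by
    have := abs_add_add_abs_sub_le u (l * v)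
    rw [abs_mul, abs_of_nonneg (by linarith : 0 ≤ l)] at this
    convert this using 3 <;> ring_nf
  have e3 : max (|v|) (l * |u|) + max (|u|) (l * |v|) ≤ 1 + l := by
    rcases max_cases (|v|) (l * |u|) with ⟨h3, -⟩ | ⟨h3, -⟩ <;>
    rcases max_cases (|u|) (l * |v|) with ⟨h4, -⟩ | ⟨h4, -⟩ <;> rw [h3, h4] <;> nlinarith
  linarith

/-- A vector close to a unit vector on a coordinate axis is transversal to the lines whose slope `l`
lies in `[1/2, 2]`. -/
theorem one_third_le_abs_sub {u v l : ℝ} (h : u ^ 2 + v ^ 2 ≤ 1)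
    (hl : l ∈ Icc (1 / 2 : ℝ) 2) (hm : 99 / 100 ≤ max |u| |v|) : 1 / 3 ≤ |v - l * u| := by
  obtain ⟨h1, h2⟩ := hl
  rw [← sq_abs u, ← sq_abs v] at h
  have hlu : |l * u| = l * |u| := by rw [abs_mul, abs_of_nonneg (by linarith)]
  rcases le_max_iff.1 hm with h3 | h3
  · have h4 : |v| ≤ 3 / 20 := by nlinarith [abs_nonneg v]
    have h5 := abs_sub_abs_le_abs_sub (l * u) v
    rw [hlu, abs_sub_comm] at h5
    nlinarith
  · have h4 : |u| ≤ 3 / 20 := by nlinarith [abs_nonneg u]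
    have h5 := abs_sub_abs_le_abs_sub v (l * u)
    rw [hlu] at h5
    nlinarith [abs_nonneg u]

namespace IsSquareBarrierParam

variable {Ω : Type*} [TopologicalSpace Ω] [MeasurableSpace Ω]
  {μ : Measure Ω} {S : Set Ω} {x y u v : Ω → ℝ}

theorem measurable_x [BorelSpace Ω] (h : IsSquareBarrierParam μ S x y u v) : Measurable x :=
  h.continuous_x.measurable

theorem measurable_y [BorelSpace Ω] (h : IsSquareBarrierParam μ S x y u v) : Measurable y :=
  h.continuous_y.measurable

theorem exists_eq_of_mem_Icc (h : IsSquareBarrierParam μ S x y u v) {a b c : ℝ}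
    (hab : a ≠ 0 ∨ b ≠ 0) (hc : c ∈ Icc (min a 0 + min b 0) (min a 0 + min b 0 + (|a| + |b|))) :
    ∃ ω ∈ S, a * x ω + b * y ω = c := by
  -- `lo` is the minimum of `a * p + b * q` over the square.
  set lo := min a 0 + min b 0
  have hpos : 0 < |a| + |b| := by
    rcases hab with h1 | h1
    · linarith [abs_pos.2 h1, abs_nonneg b]
    · linarith [abs_pos.2 h1, abs_nonneg a]
  set t := (c - lo) / (|a| + |b|) with ht
  have ht0 : 0 ≤ t := div_nonneg (by linarith [hc.1]) hpos.le
  have ht1 : t ≤ 1 := (div_le_one hpos).2 (by linarith [hc.2])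
  have key : ∀ e : ℝ, ∃ p ∈ Icc (0 : ℝ) 1, e * p = min e 0 + t * |e| := by
    intro e
    rcases le_total 0 e with h1 | h1
    · exact ⟨t, ⟨ht0, ht1⟩, by rw [min_eq_right h1, abs_of_nonneg h1]; ring⟩
    · exact ⟨1 - t, ⟨by linarith, by linarith⟩, by rw [min_eq_left h1, abs_of_nonpos h1]; ring⟩
  obtain ⟨p, hp, hp'⟩ := key a
  obtain ⟨q, hq, hq'⟩ := key b
  obtain ⟨ω, hω, he⟩ := h.exists_eq a b p q hab hp hq
  refine ⟨ω, hω, ?_⟩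
  have htc : t * (|a| + |b|) = c - lo := div_mul_cancel₀ _ hpos.ne'
  rw [he, hp', hq']
  simp only [lo] at htc ⊢
  linarith

/-- If the points of the barrier outside `T` are redundant for the lines `a * x + b * y = c` with
`c ∉ Y`, then the projection of `T`, together with `Y`, covers that of the square, of length
`|a| + |b|`. -/
theorem ofReal_width_le (h : IsSquareBarrierParam μ S x y u v) {a b : ℝ}
    (hab : a ≠ 0 ∨ b ≠ 0) {T : Set Ω} (hT : MeasurableSet T) (Y : Set ℝ)
    (hcov : ∀ ω ∈ S, ω ∉ T → a * x ω + b * y ω ∈ Y ∨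
      ∃ ω' ∈ S, ω' ∈ T ∧ a * x ω' + b * y ω' = a * x ω + b * y ω) :
    ENNReal.ofReal (|a| + |b|) ≤
      volume Y + ∫⁻ ω in T, ENNReal.ofReal |a * u ω + b * v ω| ∂μ := by
  set lo := min a 0 + min b 0
  have h1 : Icc lo (lo + (|a| + |b|)) ⊆
      Y ∪ (fun ω => a * x ω + b * y ω) '' (S ∩ T) := by
    intro c hc
    obtain ⟨ω, hω, rfl⟩ := h.exists_eq_of_mem_Icc hab hc
    by_cases hωT : ω ∈ T
    · exact Or.inr ⟨ω, ⟨hω, hωT⟩, rfl⟩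
    · rcases hcov ω hω hωT with h2 | ⟨ω', h2, h3, h4⟩
      · exact Or.inl h2
      · exact Or.inr ⟨ω', ⟨h2, h3⟩, h4⟩
  calc ENNReal.ofReal (|a| + |b|) = volume (Icc lo (lo + (|a| + |b|))) := by
        rw [Real.volume_Icc, add_sub_cancel_left]
    _ ≤ _ := measure_mono h1
    _ ≤ _ := measure_union_le _ _
    _ ≤ _ := by gcongr; exact h.volume_image_le a b T hT

theorem ofReal_width_le_lintegral (h : IsSquareBarrierParam μ S x y u v) {a b : ℝ}
    (hab : a ≠ 0 ∨ b ≠ 0) :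
    ENNReal.ofReal (|a| + |b|) ≤ ∫⁻ ω, ENNReal.ofReal |a * u ω + b * v ω| ∂μ := by
  have := h.ofReal_width_le hab MeasurableSet.univ ∅ (fun ω _ h' => absurd (mem_univ ω) h')
  simpa using this

theorem measurable_ofReal_abs (h : IsSquareBarrierParam μ S x y u v) (a b : ℝ) :
    Measurable fun ω => ENNReal.ofReal |a * u ω + b * v ω| := by
  have := h.measurable_u
  have := h.measurable_v
  have h3 : Measurable fun ω => |a * u ω + b * v ω| :=
    Measurable.comp (g := fun t : ℝ => |t|) continuous_abs.measurable (by fun_prop)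
  exact h3.ennreal_ofReal

/-- A barrier of length at most `2 + δ` wastes at most `6 * δ` of its projection along any slope
`l ∈ [1/2, 2]`: the projections along the slopes `±l`, `±1/l` add up to at most `2 * (1 + l)` times
the length, and the other three are at least as large as those of the square. -/
theorem lintegral_le (h : IsSquareBarrierParam μ S x y u v) {δ l : ℝ} (hδ : 0 ≤ δ)
    (hμ : μ univ ≤ ENNReal.ofReal (2 + δ)) (hl : l ∈ Icc (1 / 2 : ℝ) 2) :
    ∫⁻ ω, ENNReal.ofReal |-l * u ω + 1 * v ω| ∂μ ≤ ENNReal.ofReal (1 + l + 6 * δ) := by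
  have hl0 : 0 ≤ l := by linarith [hl.1]
  have hw : ENNReal.ofReal (1 + l) + ENNReal.ofReal (1 + l) + ENNReal.ofReal (1 + l) =
      ENNReal.ofReal (3 * (1 + l)) := by
    rw [← ENNReal.ofReal_add (by linarith) (by linarith),
      ← ENNReal.ofReal_add (by linarith) (by linarith)]
    congr 1; ring
  have m1 := h.measurable_ofReal_abs (-l) 1
  have m2 := h.measurable_ofReal_abs l 1
  have m3 := h.measurable_ofReal_abs 1 l
  have m23 : Measurable fun ω => ENNReal.ofReal |l * u ω + 1 * v ω| +
      ENNReal.ofReal |1 * u ω + l * v ω| := m2.add m3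
  have w2 := h.ofReal_width_le_lintegral (a := l) (b := 1) (Or.inr one_ne_zero)
  have w3 := h.ofReal_width_le_lintegral (a := 1) (b := l) (Or.inl one_ne_zero)
  have w4 := h.ofReal_width_le_lintegral (a := -1) (b := l) (Or.inl (by norm_num))
  rw [abs_of_nonneg hl0, abs_one] at w2
  rw [abs_of_nonneg hl0, abs_one] at w3
  rw [abs_of_nonneg hl0, abs_neg, abs_one] at w4
  have hsum : (∫⁻ ω, ENNReal.ofReal |-l * u ω + 1 * v ω| ∂μ) + ENNReal.ofReal (3 * (1 + l)) ≤
      ENNReal.ofReal (1 + l + 6 * δ) + ENNReal.ofReal (3 * (1 + l)) := by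
    calc _ ≤ (∫⁻ ω, ENNReal.ofReal |-l * u ω + 1 * v ω| ∂μ) +
          ((∫⁻ ω, ENNReal.ofReal |l * u ω + 1 * v ω| ∂μ) +
          (∫⁻ ω, ENNReal.ofReal |1 * u ω + l * v ω| ∂μ) +
          (∫⁻ ω, ENNReal.ofReal |-1 * u ω + l * v ω| ∂μ)) := by
          rw [← hw, add_comm l 1] at *
          gcongr
      _ = ∫⁻ ω, (ENNReal.ofReal |-l * u ω + 1 * v ω| + (ENNReal.ofReal |l * u ω + 1 * v ω| +
          ENNReal.ofReal |1 * u ω + l * v ω| + ENNReal.ofReal |-1 * u ω + l * v ω|)) ∂μ := by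
          rw [lintegral_add_left m1, lintegral_add_left m23, lintegral_add_left m2]
      _ ≤ ∫⁻ _, ENNReal.ofReal (2 * (1 + l)) ∂μ := by
          refine lintegral_mono fun ω => ?_
          dsimp only
          rw [← ENNReal.ofReal_add (abs_nonneg _) (abs_nonneg _),
            ← ENNReal.ofReal_add (by positivity) (abs_nonneg _),
            ← ENNReal.ofReal_add (abs_nonneg _) (by positivity)]
          refine ENNReal.ofReal_le_ofReal ?_
          linarith [sum_abs_le_of_speed_le (h.speed_le ω) hl]
      _ = ENNReal.ofReal (2 * (1 + l)) * μ univ := by rw [lintegral_const]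
      _ ≤ ENNReal.ofReal (2 * (1 + l)) * ENNReal.ofReal (2 + δ) := by gcongr
      _ ≤ _ := by
          rw [← ENNReal.ofReal_mul (by linarith), ← ENNReal.ofReal_add (by linarith) (by linarith)]
          refine ENNReal.ofReal_le_ofReal ?_
          nlinarith [hl.2]
  exact (ENNReal.add_le_add_iff_right ENNReal.ofReal_ne_top).1 hsum

/-- If the part `T` of the barrier is redundant for the lines of slope `l` with intercept outside
`Y`, then its projection along this slope is at most the length of `Y` plus the total waste. -/
theorem setLIntegral_compl_le (h : IsSquareBarrierParam μ S x y u v) {δ l : ℝ} (hδ : 0 ≤ δ)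
    (hμ : μ univ ≤ ENNReal.ofReal (2 + δ)) (hl : l ∈ Icc (1 / 2 : ℝ) 2)
    {T : Set Ω} (hT : MeasurableSet T) (Y : Set ℝ)
    (hcov : ∀ ω ∈ S, ω ∈ T → y ω - l * x ω ∈ Y ∨
      ∃ ω' ∈ S, ω' ∉ T ∧ y ω' - l * x ω' = y ω - l * x ω) :
    ∫⁻ ω in T, ENNReal.ofReal |v ω - l * u ω| ∂μ ≤ volume Y + ENNReal.ofReal (6 * δ) := by
  have hl0 : 0 ≤ l := by linarith [hl.1]
  have e1 : ∀ a b : ℝ, -l * a + 1 * b = b - l * a := fun a b => by ring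
  have h1 := h.lintegral_le hδ hμ hl
  have h2 := h.ofReal_width_le (a := -l) (b := 1) (Or.inr one_ne_zero) hT.compl Y (by
    intro ω hω hωT
    simp only [e1]
    exact hcov ω hω (not_not.1 hωT))
  rw [abs_neg, abs_one, abs_of_nonneg hl0] at h2
  simp only [e1] at h1 h2
  have hfin : ∫⁻ ω in Tᶜ, ENNReal.ofReal |v ω - l * u ω| ∂μ ≠ ∞ :=
    ne_top_of_le_ne_top ENNReal.ofReal_ne_top ((setLIntegral_le_lintegral _ _).trans h1)
  rw [← lintegral_add_compl _ hT, add_assoc, ENNReal.ofReal_add (by linarith) (by linarith),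
    ENNReal.ofReal_add (by linarith) (by linarith)] at h1
  have h3 : (∫⁻ ω in T, ENNReal.ofReal |v ω - l * u ω| ∂μ) +
      ∫⁻ ω in Tᶜ, ENNReal.ofReal |v ω - l * u ω| ∂μ ≤
      (volume Y + ENNReal.ofReal (6 * δ)) +
        ∫⁻ ω in Tᶜ, ENNReal.ofReal |v ω - l * u ω| ∂μ := by
    refine h1.trans ?_
    rw [← add_assoc, ← ENNReal.ofReal_add (by linarith) (by linarith), add_comm 1 l,
      add_right_comm]
    gcongr
  exact (ENNReal.add_le_add_iff_right hfin).1 h3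

end IsSquareBarrierParam

/-! ### Corner pieces and bad pairs -/

namespace IsSquareBarrierParam

variable {Ω : Type*} [TopologicalSpace Ω] [MeasurableSpace Ω]
  {μ : Measure Ω} {S : Set Ω} {x y u v : Ω → ℝ}

/-- Most of a short barrier runs almost parallel to the axes: this is where the projections to the
two diagonals, which must cover those of the square, are largest. -/
theorem measure_max_lt_le (h : IsSquareBarrierParam μ S x y u v) {δ : ℝ} (hδ : 0 ≤ δ)
    (hμ : μ univ ≤ ENNReal.ofReal (2 + δ)) :
    μ {ω | max |u ω| |v ω| < 99 / 100} ≤ ENNReal.ofReal (100 * δ) := by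
  set N : Set Ω := {ω | max |u ω| |v ω| < 99 / 100} with hN
  have hNm : MeasurableSet N := by
    refine measurableSet_lt (Measurable.max ?_ ?_) measurable_const
    · exact continuous_abs.measurable.comp h.measurable_u
    · exact continuous_abs.measurable.comp h.measurable_v
  have m1 := h.measurable_ofReal_abs 1 1
  have w1 := h.ofReal_width_le_lintegral (a := 1) (b := 1) (Or.inr one_ne_zero)
  have w2 := h.ofReal_width_le_lintegral (a := -1) (b := 1) (Or.inr one_ne_zero)
  rw [abs_one] at w1
  rw [abs_neg, abs_one] at w2
  have hind : ∫⁻ ω, N.indicator (fun _ => ENNReal.ofReal (1 / 50)) ω ∂μ =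
      ENNReal.ofReal (1 / 50) * μ N := lintegral_indicator_const hNm _
  have key : ENNReal.ofReal (1 / 50) * μ N + ENNReal.ofReal 4 ≤
      ENNReal.ofReal (2 * δ) + ENNReal.ofReal 4 := by
    calc ENNReal.ofReal (1 / 50) * μ N + ENNReal.ofReal 4
        ≤ (∫⁻ ω, N.indicator (fun _ => ENNReal.ofReal (1 / 50)) ω ∂μ) +
          ((∫⁻ ω, ENNReal.ofReal |1 * u ω + 1 * v ω| ∂μ) +
          ∫⁻ ω, ENNReal.ofReal |-1 * u ω + 1 * v ω| ∂μ) := by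
          rw [hind, show (4 : ℝ) = (1 + 1) + (1 + 1) by norm_num,
            ENNReal.ofReal_add (by norm_num : (0 : ℝ) ≤ 1 + 1) (by norm_num)]
          gcongr
      _ = ∫⁻ ω, (N.indicator (fun _ => ENNReal.ofReal (1 / 50)) ω +
          (ENNReal.ofReal |1 * u ω + 1 * v ω| + ENNReal.ofReal |-1 * u ω + 1 * v ω|)) ∂μ := by
          rw [lintegral_add_left (measurable_const.indicator hNm), lintegral_add_left m1]
      _ ≤ ∫⁻ _, ENNReal.ofReal 2 ∂μ := by
          refine lintegral_mono fun ω => ?_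
          dsimp only
          rw [← ENNReal.ofReal_add (abs_nonneg _) (abs_nonneg _)]
          have h1 := abs_add_add_abs_sub_le (u ω) (v ω)
          by_cases hω : ω ∈ N
          · rw [indicator_of_mem hω, ← ENNReal.ofReal_add (by norm_num) (by positivity)]
            refine ENNReal.ofReal_le_ofReal ?_
            have h2 : max |u ω| |v ω| < 99 / 100 := hω
            linarith
          · rw [indicator_of_notMem hω, zero_add]
            refine ENNReal.ofReal_le_ofReal ?_
            have h3 : max |u ω| |v ω| ≤ 1 := by
              refine max_le ?_ ?_ <;> refine abs_le_one_iff_mul_self_le_one.2 ?_ <;>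
              nlinarith [h.speed_le ω, sq_nonneg (u ω), sq_nonneg (v ω)]
            linarith
      _ = ENNReal.ofReal 2 * μ univ := by rw [lintegral_const]
      _ ≤ ENNReal.ofReal 2 * ENNReal.ofReal (2 + δ) := by gcongr
      _ = _ := by
          rw [← ENNReal.ofReal_mul (by norm_num), ← ENNReal.ofReal_add (by linarith) (by norm_num)]
          congr 1; ring
  have key2 := (ENNReal.add_le_add_iff_right ENNReal.ofReal_ne_top).1 key
  calc μ N = ENNReal.ofReal 50 * (ENNReal.ofReal (1 / 50) * μ N) := by
        rw [← mul_assoc, ← ENNReal.ofReal_mul (by norm_num)]; norm_num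
    _ ≤ ENNReal.ofReal 50 * ENNReal.ofReal (2 * δ) := by gcongr
    _ = _ := by rw [← ENNReal.ofReal_mul (by norm_num)]; congr 1; ring

/-- A part of the barrier that contains all its points in the strip `c₀ ≤ x + y ≤ c₀ + 1/5` blocks
all lines `x + y = c` in this strip, and hence has a definite length; removing the parameters at
which the velocity is not almost axis-parallel hardly affects this. -/
theorem ofReal_le_measure_inter (h : IsSquareBarrierParam μ S x y u v) {δ c₀ : ℝ} (hδ : 0 ≤ δ)
    (hδ' : δ ≤ 1 / 10 ^ 5)
    (hμ : μ univ ≤ ENNReal.ofReal (2 + δ)) (hc : 0 ≤ c₀) (hc' : c₀ + 1 / 5 ≤ 2)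
    {A : Set Ω} (hA : MeasurableSet A) (hAc : ∀ ω ∈ S, x ω + y ω ∈ Icc c₀ (c₀ + 1 / 5) → ω ∈ A) :
    ENNReal.ofReal (13 / 100) ≤ μ (A ∩ {ω | 99 / 100 ≤ max |u ω| |v ω|}) := by
  have h1 : Icc c₀ (c₀ + 1 / 5) ⊆ (fun ω => 1 * x ω + 1 * y ω) '' (S ∩ A) := by
    intro c hcc
    obtain ⟨ω, hω, he⟩ := h.exists_eq_of_mem_Icc (a := 1) (b := 1) (c := c) (Or.inr one_ne_zero)
      (by norm_num; exact ⟨by linarith [hcc.1], by linarith [hcc.2]⟩)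
    refine ⟨ω, ⟨hω, hAc ω hω ?_⟩, he⟩
    rw [one_mul, one_mul] at he
    rwa [he]
  have h2 : ENNReal.ofReal (1 / 5) ≤ ENNReal.ofReal (3 / 2) * μ A := by
    calc ENNReal.ofReal (1 / 5) = volume (Icc c₀ (c₀ + 1 / 5)) := by
          rw [Real.volume_Icc, add_sub_cancel_left]
      _ ≤ _ := measure_mono h1
      _ ≤ _ := h.volume_image_le 1 1 A hA
      _ ≤ ∫⁻ _ in A, ENNReal.ofReal (3 / 2) ∂μ := by
          refine lintegral_mono fun ω => ENNReal.ofReal_le_ofReal ?_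
          rw [one_mul, one_mul]
          exact abs_le_of_sq_le_sq (by nlinarith [h.speed_le ω, sq_nonneg (u ω - v ω)])
            (by norm_num)
      _ = _ := setLIntegral_const _ _
  have h3 : μ A ≤ μ (A ∩ {ω | 99 / 100 ≤ max |u ω| |v ω|}) + ENNReal.ofReal (1 / 1000) := by
    calc μ A ≤ μ ((A ∩ {ω | 99 / 100 ≤ max |u ω| |v ω|}) ∪
          {ω | max |u ω| |v ω| < 99 / 100}) := by
          refine measure_mono fun ω hω => ?_
          rcases le_or_gt (99 / 100) (max |u ω| |v ω|) with h4 | h4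
          · exact Or.inl ⟨hω, h4⟩
          · exact Or.inr h4
      _ ≤ _ := measure_union_le _ _
      _ ≤ _ := by
          gcongr
          exact (h.measure_max_lt_le hδ hμ).trans (ENNReal.ofReal_le_ofReal (by linarith))
  have h4 : ENNReal.ofReal (2 / 15) ≤ μ A := by
    calc ENNReal.ofReal (2 / 15) = ENNReal.ofReal (2 / 3) * ENNReal.ofReal (1 / 5) := by
          rw [← ENNReal.ofReal_mul (by norm_num)]; norm_num
      _ ≤ ENNReal.ofReal (2 / 3) * (ENNReal.ofReal (3 / 2) * μ A) := by gcongr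
      _ = _ := by rw [← mul_assoc, ← ENNReal.ofReal_mul (by norm_num)]; norm_num
  have h5 : ENNReal.ofReal (13 / 100) + ENNReal.ofReal (1 / 1000) ≤
      μ (A ∩ {ω | 99 / 100 ≤ max |u ω| |v ω|}) + ENNReal.ofReal (1 / 1000) := by
    refine le_trans ?_ (h4.trans h3)
    rw [← ENNReal.ofReal_add (by norm_num) (by norm_num)]
    exact ENNReal.ofReal_le_ofReal (by norm_num)
  exact (ENNReal.add_le_add_iff_right ENNReal.ofReal_ne_top).1 h5

end IsSquareBarrierParam

theorem IsSigmaCompact.measurableSet {X : Type*} [TopologicalSpace X] [T2Space X]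
    [MeasurableSpace X] [OpensMeasurableSpace X] {s : Set X} (hs : IsSigmaCompact s) :
    MeasurableSet s := by
  obtain ⟨K, hK, rfl⟩ := hs
  exact .iUnion fun n => (hK n).measurableSet

/-- The barrier is crowded at `ω` along the slope `l` if, for some `r > 0`, the part of it that lies
between the line of slope `l` through `ω` and its translate by `r` upwards has a projection of total
length, counted with multiplicity, more than `2 * r`. -/
def IsCrowded {Ω : Type*} [MeasurableSpace Ω] (μ : Measure Ω) (x y u v : Ω → ℝ) (l : ℝ) (ω : Ω) :
    Prop :=
  ∃ r : ℝ, 0 < r ∧ ENNReal.ofReal (2 * r) <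
    ∫⁻ ω' in {ω' | y ω' - l * x ω' ∈ Icc (y ω - l * x ω) (y ω - l * x ω + r)},
      ENNReal.ofReal |v ω' - l * u ω'| ∂μ

/-- The pairs `(l, ω)` of a slope in `[1/2, 2]` and a parameter in `A`, with almost axis-parallel
velocity, for which the line of slope `l` through `ω` meets `B` or the barrier is crowded at `ω`
along `l`. -/
def badPairs {Ω : Type*} [MeasurableSpace Ω] (μ : Measure Ω) (x y u v : Ω → ℝ) (A B : Set Ω) :
    Set (ℝ × Ω) :=
  {p | p.1 ∈ Icc (1 / 2 : ℝ) 2 ∧ p.2 ∈ A ∧ 99 / 100 ≤ max |u p.2| |v p.2| ∧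
    ((∃ ω ∈ B, y ω - p.1 * x ω = y p.2 - p.1 * x p.2) ∨ IsCrowded μ x y u v p.1 p.2)}

namespace IsSquareBarrierParam

variable {Ω : Type*} [TopologicalSpace Ω] [MeasurableSpace Ω]
  {μ : Measure Ω} {S : Set Ω} {x y u v : Ω → ℝ}

/-- In the definition of `IsCrowded` it suffices to consider rational `r`. -/
theorem measurableSet_setOf_isCrowded [BorelSpace Ω] [SFinite μ]
    (h : IsSquareBarrierParam μ S x y u v) :
    MeasurableSet {p : ℝ × Ω | IsCrowded μ x y u v p.1 p.2} := by
  have hu := h.measurable_u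
  have hv := h.measurable_v
  have hx := h.measurable_x
  have hy := h.measurable_y
  set F : ℝ → ℝ × Ω → ℝ≥0∞ := fun r p =>
    ∫⁻ ω' in {ω' | y ω' - p.1 * x ω' ∈ Icc (y p.2 - p.1 * x p.2) (y p.2 - p.1 * x p.2 + r)},
      ENNReal.ofReal |v ω' - p.1 * u ω'| ∂μ with hF
  have hset : ∀ p : ℝ × Ω, ∀ r, MeasurableSet
      {ω' | y ω' - p.1 * x ω' ∈ Icc (y p.2 - p.1 * x p.2) (y p.2 - p.1 * x p.2 + r)} := by
    intro p r
    exact measurableSet_Icc.preimage (hy.sub (measurable_const.mul hx))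
  have hFm : ∀ r, Measurable (F r) := by
    intro r
    set D : Set ((ℝ × Ω) × Ω) := {q | y q.2 - q.1.1 * x q.2 ∈
      Icc (y q.1.2 - q.1.1 * x q.1.2) (y q.1.2 - q.1.1 * x q.1.2 + r)} with hD
    have hDm : MeasurableSet D := by
      have : D = {q : (ℝ × Ω) × Ω | y q.1.2 - q.1.1 * x q.1.2 ≤ y q.2 - q.1.1 * x q.2} ∩
          {q : (ℝ × Ω) × Ω | y q.2 - q.1.1 * x q.2 ≤ y q.1.2 - q.1.1 * x q.1.2 + r} := rfl
      rw [this]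
      refine (measurableSet_le ?_ ?_).inter (measurableSet_le ?_ ?_) <;> fun_prop
    have hg : Measurable fun q : (ℝ × Ω) × Ω => ENNReal.ofReal |v q.2 - q.1.1 * u q.2| := by
      refine Measurable.ennreal_ofReal (continuous_abs.measurable.comp ?_)
      fun_prop
    have h1 := (hg.indicator hDm).lintegral_prod_right' (ν := μ)
    convert h1 using 2 with p
    rw [hF]
    dsimp only
    rw [← lintegral_indicator (hset p r)]
    rfl
  have : {p : ℝ × Ω | IsCrowded μ x y u v p.1 p.2} =
      ⋃ q : {q : ℚ // 0 < q}, {p | ENNReal.ofReal (2 * (q : ℚ)) < F (q : ℚ) p} := by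
    ext p
    simp only [mem_ofPred_eq, mem_iUnion, Subtype.exists]
    constructor
    · rintro ⟨r, hr, hlt⟩
      have hcont : Tendsto (fun s : ℝ => ENNReal.ofReal (2 * s)) (𝓝[>] r)
          (𝓝 (ENNReal.ofReal (2 * r))) :=
        (ENNReal.continuous_ofReal.comp (by fun_prop)).continuousAt.tendsto.mono_left
          nhdsWithin_le_nhds
      have h1 := hcont.eventually (gt_mem_nhds hlt)
      rw [eventually_nhdsWithin_iff, Metric.eventually_nhds_iff] at h1
      obtain ⟨ε, hε, h2⟩ := h1
      obtain ⟨q, hq1, hq2⟩ := exists_rat_btwn (show r < r + ε by linarith)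
      refine ⟨q, by exact_mod_cast hr.trans hq1, ?_⟩
      refine (h2 (y := q) ?_ hq1).trans_le ?_
      · rw [Real.dist_eq, abs_of_pos (by linarith)]; linarith
      · exact lintegral_mono_set fun ω' hω' => ⟨hω'.1, hω'.2.trans (by linarith)⟩
    · rintro ⟨q, hq, hlt⟩
      exact ⟨q, by exact_mod_cast hq, hlt⟩
  rw [this]
  exact .iUnion fun q => measurableSet_lt measurable_const (hFm _)

theorem measurableSet_badPairs [BorelSpace Ω] [T2Space Ω] [SecondCountableTopology Ω]
    [SigmaCompactSpace Ω] [SFinite μ]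
    (h : IsSquareBarrierParam μ S x y u v) {A B : Set Ω} (hA : MeasurableSet A)
    (hB : IsClosed B) :
    MeasurableSet (badPairs μ x y u v A B) := by
  have hx := h.continuous_x
  have hy := h.continuous_y
  have h1 : MeasurableSet {p : ℝ × Ω | ∃ ω ∈ B, y ω - p.1 * x ω = y p.2 - p.1 * x p.2} := by
    have hcl : IsClosed {q : (ℝ × Ω) × Ω | q.2 ∈ B ∧
        y q.2 - q.1.1 * x q.2 = y q.1.2 - q.1.1 * x q.1.2} :=
      (hB.preimage continuous_snd).inter (isClosed_eq (by fun_prop) (by fun_prop))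
    have hσ := (isSigmaCompact_univ.of_isClosed_subset hcl (subset_univ _)).image
      (continuous_fst : Continuous (Prod.fst : (ℝ × Ω) × Ω → ℝ × Ω))
    convert hσ.measurableSet using 1
    ext p
    simp only [mem_ofPred_eq, mem_image, Prod.exists]
    constructor
    · rintro ⟨ω, hω, he⟩; exact ⟨p.1, p.2, ω, ⟨hω, he⟩, rfl⟩
    · rintro ⟨a, b, ω, ⟨hω, he⟩, rfl⟩; exact ⟨ω, hω, he⟩
  have h2 : MeasurableSet {ω | 99 / 100 ≤ max |u ω| |v ω|} := by
    refine measurableSet_le measurable_const (Measurable.max ?_ ?_)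
    · exact continuous_abs.measurable.comp h.measurable_u
    · exact continuous_abs.measurable.comp h.measurable_v
  exact (measurableSet_Icc.preimage measurable_fst).inter ((hA.preimage measurable_snd).inter
    ((h2.preimage measurable_snd).inter (h1.union h.measurableSet_setOf_isCrowded)))

end IsSquareBarrierParam

/-! ### Counting bad pairs in two ways -/

namespace IsSquareBarrierParam

variable {Ω : Type*} [TopologicalSpace Ω] [MeasurableSpace Ω]
  {μ : Measure Ω} {S : Set Ω} {x y u v : Ω → ℝ}

theorem measurable_ofReal_abs_sub (h : IsSquareBarrierParam μ S x y u v) (l : ℝ) :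
    Measurable fun ω => ENNReal.ofReal |v ω - l * u ω| := by
  have := h.measurable_ofReal_abs (-l) 1
  convert this using 4
  ring

theorem le_three_mul_lintegral (h : IsSquareBarrierParam μ S x y u v) {l : ℝ}
    (hl : l ∈ Icc (1 / 2 : ℝ) 2) {T : Set Ω} (hT : MeasurableSet T)
    (hm : ∀ ω ∈ T, 99 / 100 ≤ max |u ω| |v ω|) :
    μ T ≤ 3 * ∫⁻ ω in T, ENNReal.ofReal |v ω - l * u ω| ∂μ := by
  rw [← lintegral_const_mul _ (h.measurable_ofReal_abs_sub l), ← setLIntegral_one]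
  refine setLIntegral_mono' hT fun ω hω => ?_
  have h1 := one_third_le_abs_sub (h.speed_le ω) hl (hm ω hω)
  rw [← ENNReal.ofReal_ofNat 3, ← ENNReal.ofReal_mul (by norm_num), ← ENNReal.ofReal_one]
  exact ENNReal.ofReal_le_ofReal (by linarith)

/-- The parameters at which the barrier is crowded contribute at most five times the waste, by the
maximal inequality for the projected arc length. -/
theorem lintegral_isCrowded_le [BorelSpace Ω] [IsFiniteMeasure μ]
    (h : IsSquareBarrierParam μ S x y u v) {δ l : ℝ}
    (hδ : 0 ≤ δ) (hμ : μ univ ≤ ENNReal.ofReal (2 + δ)) (hl : l ∈ Icc (1 / 2 : ℝ) 2) :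
    ∫⁻ ω in {ω | IsCrowded μ x y u v l ω}, ENNReal.ofReal |v ω - l * u ω| ∂μ ≤
      ENNReal.ofReal (30 * δ) := by
  have hcm : MeasurableSet {ω | IsCrowded μ x y u v l ω} :=
    h.measurableSet_setOf_isCrowded.preimage (measurable_const.prodMk measurable_id)
      (f := fun ω => (l, ω))
  set f : Ω → ℝ := fun ω => y ω - l * x ω with hf
  have hfm : Measurable f := h.measurable_y.sub (h.measurable_x.const_mul l)
  set κ := μ.withDensity fun ω => ENNReal.ofReal |v ω - l * u ω| with hκ
  have hκT : ∀ T, MeasurableSet T → κ T = ∫⁻ ω in T, ENNReal.ofReal |v ω - l * u ω| ∂μ :=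
    fun T hT => withDensity_apply _ hT
  have hκfin : IsFiniteMeasure κ := by
    refine isFiniteMeasure_withDensity ?_
    have h1 := h.lintegral_le hδ hμ hl
    have e1 : ∀ a b : ℝ, -l * a + 1 * b = b - l * a := fun a b => by ring
    simp only [e1] at h1
    exact ne_top_of_le_ne_top ENNReal.ofReal_ne_top h1
  have hfin : IsFiniteMeasure (κ.map f) := Measure.isFiniteMeasure_map κ f
  have hW : ∀ Y, MeasurableSet Y → κ.map f Y ≤ volume Y + ENNReal.ofReal (6 * δ) := by
    intro Y hY
    rw [Measure.map_apply hfm hY, hκT _ (hY.preimage hfm)]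
    exact h.setLIntegral_compl_le hδ hμ hl (hY.preimage hfm) Y fun ω _ hω => Or.inl hω
  have h1 := measure_setOf_dense_interval_le hW
  rw [← hκT _ hcm]
  refine le_trans ?_ (h1.trans (le_of_eq ?_))
  · refine le_trans (le_of_eq ?_) (Measure.le_map_apply hfm.aemeasurable _)
    congr 1
    ext ω
    refine exists_congr fun r => and_congr_right fun _ => ?_
    rw [Measure.map_apply hfm measurableSet_Icc, hκT _ (measurableSet_Icc.preimage hfm)]
    rfl
  · rw [← ENNReal.ofReal_ofNat 5, ← ENNReal.ofReal_mul (by norm_num)]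
    congr 1; ring

/-- For a fixed slope few parameters are bad: the part of `A` whose lines meet `B` is redundant for
this slope, and the crowded part is controlled by the maximal inequality. -/
theorem measure_slice_badPairs_le [BorelSpace Ω] [T2Space Ω] [SecondCountableTopology Ω]
    [SigmaCompactSpace Ω] [IsFiniteMeasure μ] (h : IsSquareBarrierParam μ S x y u v) {δ l : ℝ}
    (hδ : 0 ≤ δ) (hμ : μ univ ≤ ENNReal.ofReal (2 + δ)) (hl : l ∈ Icc (1 / 2 : ℝ) 2)
    {A B : Set Ω} (hA : MeasurableSet A) (hB : IsClosed B) (hBS : B ⊆ S) (hAB : Disjoint A B) :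
    μ (Prod.mk l ⁻¹' badPairs μ x y u v A B) ≤ ENNReal.ofReal (108 * δ) := by
  have hbm := h.measurableSet_badPairs hA hB
  have hPm : MeasurableSet (Prod.mk l ⁻¹' badPairs μ x y u v A B) :=
    hbm.preimage measurable_prodMk_left
  have hcm : MeasurableSet {ω | IsCrowded μ x y u v l ω} :=
    h.measurableSet_setOf_isCrowded.preimage (measurable_const.prodMk measurable_id)
      (f := fun ω => (l, ω))
  set P := Prod.mk l ⁻¹' badPairs μ x y u v A B with hP
  have h1 : ∫⁻ ω in P \ {ω | IsCrowded μ x y u v l ω}, ENNReal.ofReal |v ω - l * u ω| ∂μ ≤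
      ENNReal.ofReal (6 * δ) := by
    have := h.setLIntegral_compl_le hδ hμ hl (MeasurableSet.diff hPm hcm) ∅ (by
      rintro ω - ⟨hω, hωc⟩
      rcases hω.2.2.2 with ⟨ω', hω', he⟩ | hc
      · refine Or.inr ⟨ω', hBS hω', fun h' => ?_, he⟩
        exact disjoint_left.1 hAB h'.1.2.1 hω'
      · exact absurd hc hωc)
    simpa using this
  have h2 : ∫⁻ ω in P, ENNReal.ofReal |v ω - l * u ω| ∂μ ≤ ENNReal.ofReal (36 * δ) := by
    calc _ ≤ ∫⁻ ω in (P \ {ω | IsCrowded μ x y u v l ω}) ∪ {ω | IsCrowded μ x y u v l ω},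
          ENNReal.ofReal |v ω - l * u ω| ∂μ :=
          lintegral_mono_set (by rw [sdiff_union_self]; exact subset_union_left)
      _ ≤ _ := lintegral_union_le _ _ _
      _ ≤ ENNReal.ofReal (6 * δ) + ENNReal.ofReal (30 * δ) :=
          add_le_add h1 (h.lintegral_isCrowded_le hδ hμ hl)
      _ = _ := by rw [← ENNReal.ofReal_add (by linarith) (by linarith)]; congr 1; ring
  calc μ P ≤ 3 * ∫⁻ ω in P, ENNReal.ofReal |v ω - l * u ω| ∂μ :=
        h.le_three_mul_lintegral hl hPm fun ω hω => hω.2.2.1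
    _ ≤ 3 * ENNReal.ofReal (36 * δ) := by gcongr
    _ = _ := by
      rw [← ENNReal.ofReal_ofNat 3, ← ENNReal.ofReal_mul (by norm_num)]; congr 1; ring

/-- For a fixed `ω ∈ A` many slopes are bad. The slopes `s` of the lines from `ω` to the points of
`B` lie in `[3/5, 5/3]`; let `m` be their distribution with respect to arc length. It lives on bad
slopes. The points of `B` whose slope lies in `[l, l + ℓ)` are between the line of slope `l` through
`ω` and its translate by `ℓ` upwards, because they are at horizontal distance at most `1` from `ω`;
so `m [l, l + ℓ) ≤ 6 * ℓ` unless `l` is bad, and the rising-sun estimate applies. -/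
theorem le_volume_slice_badPairs [BorelSpace Ω] [T2Space Ω] [SecondCountableTopology Ω]
    [SigmaCompactSpace Ω] [IsFiniteMeasure μ] (h : IsSquareBarrierParam μ S x y u v)
    {A B : Set Ω} (hA : MeasurableSet A) (hB : IsClosed B) (hAS : A ⊆ S) (hBS : B ⊆ S)
    (hA' : ∀ ω ∈ A, x ω + y ω ≤ 1 / 5) (hB' : ∀ ω ∈ B, 9 / 5 ≤ x ω + y ω)
    (hBm : ENNReal.ofReal (13 / 100) ≤ μ (B ∩ {ω | 99 / 100 ≤ max |u ω| |v ω|}))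
    {ω : Ω} (hω : ω ∈ A) (hωm : 99 / 100 ≤ max |u ω| |v ω|) :
    ENNReal.ofReal (13 / 600) ≤ volume ((fun l => (l, ω)) ⁻¹' badPairs μ x y u v A B) := by
  have hbm := h.measurableSet_badPairs hA hB
  set E := (fun l : ℝ => (l, ω)) ⁻¹' badPairs μ x y u v A B with hE
  have hEm : MeasurableSet E := hbm.preimage measurable_prodMk_right
  set B' := B ∩ {ω | 99 / 100 ≤ max |u ω| |v ω|} with hB'def
  have hB'm : MeasurableSet B' := by
    refine hB.measurableSet.inter (measurableSet_le measurable_const (Measurable.max ?_ ?_))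
    · exact continuous_abs.measurable.comp h.measurable_u
    · exact continuous_abs.measurable.comp h.measurable_v
  set s : Ω → ℝ := fun ω' => (y ω' - y ω) / (x ω' - x ω) with hs
  have hsm : Measurable s :=
    (h.measurable_y.sub_const _).div (h.measurable_x.sub_const _)
  set m : Measure ℝ := (μ.restrict B').map s with hm
  have hmfin : IsFiniteMeasure m := Measure.isFiniteMeasure_map _ _
  have hmap : ∀ Y, MeasurableSet Y → m Y = μ (s ⁻¹' Y ∩ B') := fun Y hY => by
    rw [hm, Measure.map_apply hsm hY, Measure.restrict_apply (hY.preimage hsm)]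
  have hgeom : ∀ ω' ∈ B, 0 < x ω' - x ω ∧ x ω' - x ω ≤ 1 ∧ 3 / 5 ≤ s ω' ∧ s ω' ≤ 5 / 3 ∧
      s ω' * (x ω' - x ω) = y ω' - y ω := by
    intro ω' hω'
    have a1 := h.x_mem ω (hAS hω)
    have a2 := h.y_mem ω (hAS hω)
    have b1 := h.x_mem ω' (hBS hω')
    have b2 := h.y_mem ω' (hBS hω')
    have a3 := hA' ω hω
    have b3 := hB' ω' hω'
    have hpos : 0 < x ω' - x ω := by linarith [a1.1, a1.2, a2.1, a2.2, b1.1, b1.2, b2.1, b2.2]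
    refine ⟨hpos, by linarith [a1.1, b1.2], ?_, ?_, div_mul_cancel₀ _ hpos.ne'⟩
    · rw [hs, le_div_iff₀ hpos]; linarith [a1.1, a1.2, a2.1, a2.2, b1.1, b1.2, b2.1, b2.2]
    · rw [hs, div_le_iff₀ hpos]; linarith [a1.1, a1.2, a2.1, a2.2, b1.1, b1.2, b2.1, b2.2]
  have key := min_le_mul_volume_of_measure_Ico_le (μ := m) (E := E) (p := 1 / 2) (q := 3 / 5)
    (Λ := 6) (by norm_num) ?_ ?_ ?_
  · have hmu : m univ = μ B' := by rw [hmap _ MeasurableSet.univ]; simp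
    have h1 : ENNReal.ofReal (13 / 100) ≤ ENNReal.ofReal 6 * volume E := by
      refine le_trans (le_min (ENNReal.ofReal_le_ofReal (by norm_num)) ?_) key
      rw [hmu]; exact hBm
    calc ENNReal.ofReal (13 / 600) = ENNReal.ofReal (1 / 6) * ENNReal.ofReal (13 / 100) := by
          rw [← ENNReal.ofReal_mul (by norm_num)]; norm_num
      _ ≤ ENNReal.ofReal (1 / 6) * (ENNReal.ofReal 6 * volume E) := by gcongr
      _ = volume E := by rw [← mul_assoc, ← ENNReal.ofReal_mul (by norm_num)]; norm_num
  · rw [hmap _ hEm.compl]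
    convert measure_empty (μ := μ)
    rw [eq_empty_iff_forall_notMem]
    rintro ω' ⟨hω'E, hω'B⟩
    obtain ⟨g1, g2, g3, g4, g5⟩ := hgeom ω' hω'B.1
    refine hω'E ⟨⟨by linarith, by linarith⟩, hω, hωm, Or.inl ⟨ω', hω'B.1, ?_⟩⟩
    dsimp only
    linarith
  · rw [hmap _ measurableSet_Iio]
    convert measure_empty (μ := μ)
    rw [eq_empty_iff_forall_notMem]
    rintro ω' ⟨hω', hω'B⟩
    exact absurd (hgeom ω' hω'B.1).2.2.1 (not_le.2 hω')
  · intro l hl hlE ℓ hℓ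
    rw [hmap _ measurableSet_Ico]
    have hTm : MeasurableSet (s ⁻¹' Ico l (l + ℓ) ∩ B') :=
      (measurableSet_Ico.preimage hsm).inter hB'm
    rcases le_or_gt l 2 with hl2 | hl2
    · have hcr : ¬ IsCrowded μ x y u v l ω := fun hc =>
        hlE ⟨⟨hl, hl2⟩, hω, hωm, Or.inr hc⟩
      have hcr' : ∫⁻ ω' in {ω' | y ω' - l * x ω' ∈ Icc (y ω - l * x ω) (y ω - l * x ω + ℓ)},
          ENNReal.ofReal |v ω' - l * u ω'| ∂μ ≤ ENNReal.ofReal (2 * ℓ) := by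
        by_contra! hlt
        exact hcr ⟨ℓ, hℓ, hlt⟩
      calc μ (s ⁻¹' Ico l (l + ℓ) ∩ B')
          ≤ 3 * ∫⁻ ω' in s ⁻¹' Ico l (l + ℓ) ∩ B', ENNReal.ofReal |v ω' - l * u ω'| ∂μ :=
            h.le_three_mul_lintegral ⟨hl, hl2⟩ hTm fun ω' hω' => hω'.2.2
        _ ≤ 3 * ENNReal.ofReal (2 * ℓ) := by
            gcongr
            refine (lintegral_mono_set ?_).trans hcr'
            rintro ω' ⟨⟨hs1, hs2⟩, hω'B⟩
            obtain ⟨g1, g2, g3, g4, g5⟩ := hgeom ω' hω'B.1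
            have e : y ω' - l * x ω' - (y ω - l * x ω) = (s ω' - l) * (x ω' - x ω) := by
              linarith
            constructor
            · have := mul_nonneg (sub_nonneg.2 hs1) g1.le
              linarith
            · have : (s ω' - l) * (x ω' - x ω) ≤ ℓ * 1 :=
                mul_le_mul (by linarith) g2 g1.le hℓ.le
              linarith
        _ = ENNReal.ofReal (6 * ℓ) := by
            rw [← ENNReal.ofReal_ofNat 3, ← ENNReal.ofReal_mul (by norm_num)]; congr 1; ring
    · refine le_of_eq_of_le ?_ zero_le
      convert measure_empty (μ := μ)
      rw [eq_empty_iff_forall_notMem]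
      rintro ω' ⟨hω', hω'B⟩
      linarith [(hgeom ω' hω'B.1).2.2.2.1, hω'.1]

/-- The measure of the set of bad pairs for the corner pieces `x + y ≤ 1/5` and `x + y ≥ 9/5` of
the barrier, computed in both orders, would be at least `(13/600) * (13/100) > 0.0028` and at most
`108 * 10⁻⁵ * (3/2) = 0.00162` if the length were less than `2 + 10⁻⁵`. -/
theorem ofReal_le_measure_univ [BorelSpace Ω] [T2Space Ω] [SecondCountableTopology Ω]
    [SigmaCompactSpace Ω] [IsFiniteMeasure μ] (h : IsSquareBarrierParam μ S x y u v) :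
    ENNReal.ofReal (2 + 1 / 10 ^ 5) ≤ μ univ := by
  by_contra! hlt
  have hμ := hlt.le
  have hδ : (0 : ℝ) ≤ 1 / 10 ^ 5 := by positivity
  have hx := h.continuous_x
  have hy := h.continuous_y
  set A : Set Ω := S ∩ {ω | x ω + y ω ≤ 1 / 5} with hA
  set B : Set Ω := S ∩ {ω | 9 / 5 ≤ x ω + y ω} with hB
  have hAc : IsClosed A := h.isClosed.inter (isClosed_le (hx.add hy) continuous_const)
  have hBc : IsClosed B := h.isClosed.inter (isClosed_le continuous_const (hx.add hy))
  have hAm := h.ofReal_le_measure_inter hδ le_rfl hμ (c₀ := 0) le_rfl (by norm_num)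
    hAc.measurableSet fun ω hω hs => ⟨hω, by simpa using hs.2⟩
  have hBm := h.ofReal_le_measure_inter hδ le_rfl hμ (c₀ := 9 / 5) (by norm_num) (by norm_num)
    hBc.measurableSet fun ω hω hs => ⟨hω, hs.1⟩
  have hAB : Disjoint A B := by
    rw [disjoint_left]
    intro ω h1 h2
    linarith [show x ω + y ω ≤ 1 / 5 from h1.2, show 9 / 5 ≤ x ω + y ω from h2.2]
  have hm := h.measurableSet_badPairs hAc.measurableSet hBc
  set A' := A ∩ {ω | 99 / 100 ≤ max |u ω| |v ω|} with hA'def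
  have hA'm : MeasurableSet A' := by
    refine hAc.measurableSet.inter (measurableSet_le measurable_const (Measurable.max ?_ ?_))
    · exact continuous_abs.measurable.comp h.measurable_u
    · exact continuous_abs.measurable.comp h.measurable_v
  have hup : (volume.prod μ) (badPairs μ x y u v A B) ≤ ENNReal.ofReal (162 / 10 ^ 5) := by
    rw [Measure.prod_apply hm]
    calc _ ≤ ∫⁻ l, (Icc (1 / 2 : ℝ) 2).indicator
          (fun _ => ENNReal.ofReal (108 * (1 / 10 ^ 5))) l := by
          refine lintegral_mono fun l => ?_
          by_cases hl : l ∈ Icc (1 / 2 : ℝ) 2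
          · rw [indicator_of_mem hl]
            exact h.measure_slice_badPairs_le hδ hμ hl hAc.measurableSet hBc (fun _ h => h.1) hAB
          · rw [indicator_of_notMem hl]
            refine (measure_mono_null ?_ (measure_empty (μ := μ))).le
            exact fun ω hω => absurd hω.1 hl
      _ = _ := by
          rw [lintegral_indicator_const measurableSet_Icc, Real.volume_Icc,
            ← ENNReal.ofReal_mul (by norm_num)]
          norm_num
  have hlow : ENNReal.ofReal (13 / 600 * (13 / 100)) ≤
      (volume.prod μ) (badPairs μ x y u v A B) := by
    rw [Measure.prod_apply_symm hm]
    calc _ = ENNReal.ofReal (13 / 600) * ENNReal.ofReal (13 / 100) :=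
          ENNReal.ofReal_mul (by norm_num)
      _ ≤ ENNReal.ofReal (13 / 600) * μ A' := by gcongr
      _ = ∫⁻ ω, A'.indicator (fun _ => ENNReal.ofReal (13 / 600)) ω ∂μ :=
          (lintegral_indicator_const hA'm _).symm
      _ ≤ _ := by
          refine lintegral_mono fun ω => ?_
          by_cases hω : ω ∈ A'
          · rw [indicator_of_mem hω]
            exact h.le_volume_slice_badPairs hAc.measurableSet hBc (fun _ h => h.1)
              (fun _ h => h.1) (fun _ h => h.2) (fun _ h => h.2) hBm hω.1 hω.2
          · rw [indicator_of_notMem hω]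
            exact zero_le
  have := hlow.trans hup
  rw [ENNReal.ofReal_le_ofReal_iff (by norm_num)] at this
  norm_num at this

end IsSquareBarrierParam

/-! ### Parametrization of the barrier -/

/-- The curves of an interior barrier, parametrized by arc length, form a parametrization over
`ι × ℝ`. -/
theorem exists_isSquareBarrierParam {ι : Type*} [TopologicalSpace ι] [DiscreteTopology ι]
    [MeasurableSpace ι] [BorelSpace ι] [Countable ι] (γ : ι → C(I, Plane))
    (hγ : IsInteriorBarrier unitSquare γ) :
    ∃ (μ : Measure (ι × ℝ)) (S : Set (ι × ℝ)) (x y u v : ι × ℝ → ℝ),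
      IsSquareBarrierParam μ S x y u v ∧ μ univ = totalLength γ := by
  choose c hc him using fun i => exists_arclength_param (γ i) (hγ.rectifiable i)
  set S : Set (ι × ℝ) := {ω | ω.2 ∈ Icc 0 (curveLength (γ ω.1)).toReal} with hS
  have hcl : IsClosed S := by
    have hL : Continuous fun ω : ι × ℝ => (curveLength (γ ω.1)).toReal :=
      continuous_of_discreteTopology.comp continuous_fst (g := fun i => (curveLength (γ i)).toReal)
    exact (isClosed_le continuous_const continuous_snd).inter (isClosed_le continuous_snd hL)
  set μ₀ : Measure (ι × ℝ) := Measure.count.prod volume with hμ₀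
  have hμ₀i : ∀ f : ι × ℝ → ℝ≥0∞, Measurable f →
      ∫⁻ ω, f ω ∂μ₀ = ∑' i, ∫⁻ t, f (i, t) := by
    intro f hf
    rw [hμ₀, lintegral_prod _ hf.aemeasurable, lintegral_count]
  have hcmem : ∀ ω ∈ S, c ω.1 ω.2 ∈ curveUnion γ := by
    intro ω hω
    refine mem_iUnion.2 ⟨ω.1, ?_⟩
    rw [← him]
    exact mem_image_of_mem _ hω
  have hcoord : ∀ j : Fin 2, LipschitzWith 1 fun p : Plane => p j := fun j =>
    LipschitzWith.of_dist_le_mul fun p q => by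
      rw [NNReal.coe_one, one_mul, dist_eq_norm, dist_eq_norm]
      exact PiLp.norm_apply_le (p - q) j
  have hcj : ∀ j i, LipschitzWith 1 fun t => c i t j := fun j i => by
    have h1 := (hcoord j).comp (hc i)
    rwa [one_mul] at h1
  have hcont : ∀ j : Fin 2, Continuous fun ω : ι × ℝ => c ω.1 ω.2 j := fun j =>
    continuous_prod_of_discrete_left.2 fun i => (hcj j i).continuous
  have hdm : ∀ j : Fin 2, Measurable fun ω : ι × ℝ => deriv (c ω.1) ω.2 j := fun j =>
    measurable_from_prod_countable_right fun i =>
      (by fun_prop : Measurable fun p : Plane => p j).comp (measurable_deriv (c i))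
  refine ⟨μ₀.restrict S, S, fun ω => c ω.1 ω.2 0, fun ω => c ω.1 ω.2 1,
    fun ω => deriv (c ω.1) ω.2 0, fun ω => deriv (c ω.1) ω.2 1, ?_, ?_⟩
  · refine ⟨hcl, ?_, hcont 0, hcont 1, hdm 0, hdm 1, ?_, ?_, ?_, ?_, ?_⟩
    · rw [Measure.restrict_apply hcl.measurableSet.compl, compl_inter_self, measure_empty]
    · intro ω
      have h1 : ‖deriv (c ω.1) ω.2‖ ≤ 1 := by
        simpa using norm_deriv_le_of_lipschitz (hc ω.1)
      have h2 := EuclideanSpace.norm_sq_eq (deriv (c ω.1) ω.2)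
      rw [Fin.sum_univ_two, Real.norm_eq_abs, Real.norm_eq_abs, sq_abs, sq_abs] at h2
      rw [← h2]
      nlinarith [norm_nonneg (deriv (c ω.1) ω.2)]
    · exact fun ω hω => hγ.subset (hcmem ω hω) 0
    · exact fun ω hω => hγ.subset (hcmem ω hω) 1
    · intro a b p q hab hp hq
      -- The level line of `a * x + b * y` through `(p, q)` has direction `(-b, a)`.
      have hv : (!₂[-b, a] : Plane) ≠ 0 := by
        intro h0
        have h1 : -b = 0 := by simpa using congrArg (fun w : Plane => w 0) h0
        have h2 : a = 0 := by simpa using congrArg (fun w : Plane => w 1) h0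
        rcases hab with h | h
        · exact h h2
        · exact h (neg_eq_zero.1 h1)
      obtain ⟨z, ⟨t, hz⟩, hzΓ⟩ := hγ.isBarrier !₂[p, q] !₂[-b, a] hv
        ⟨!₂[p, q], ⟨0, by simp⟩, fun i => by fin_cases i <;> simpa⟩
      obtain ⟨i, hi⟩ := mem_iUnion.1 hzΓ
      rw [← him i] at hi
      obtain ⟨r, hr, hrz⟩ := hi
      refine ⟨(i, r), hr, ?_⟩
      have e0 : z 0 = p + t * (-b) := by rw [hz]; simp
      have e1 : z 1 = q + t * a := by rw [hz]; simp
      simp only [hrz, e0, e1]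
      ring
    · intro a b T hT
      set K : ι → Set ℝ := fun i => {t | (i, t) ∈ S ∩ T} with hK
      have hKm : ∀ i, MeasurableSet (K i) := fun i =>
        (hcl.measurableSet.inter hT).preimage measurable_prodMk_left
      have hg : ∀ i, ∃ C : NNReal, LipschitzWith C fun t => a * c i t 0 + b * c i t 1 := by
        intro i
        exact ⟨_, ((lipschitzWith_smul a).comp (hcj 0 i)).add ((lipschitzWith_smul b).comp (hcj 1 i))⟩
      have hderiv : ∀ i, ∀ᵐ t, deriv (fun t => a * c i t 0 + b * c i t 1) t =
          a * deriv (c i) t 0 + b * deriv (c i) t 1 := by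
        intro i
        filter_upwards [(hc i).ae_differentiableAt_real] with t ht
        have h1 : ∀ j : Fin 2, HasDerivAt (fun t => c i t j) (deriv (c i) t j) t := fun j =>
          
          (EuclideanSpace.proj (𝕜 := ℝ) j).hasFDerivAt.comp_hasDerivAt t ht.hasDerivAt
        exact (((h1 0).const_mul a).add ((h1 1).const_mul b)).deriv
      have hG : Measurable fun ω : ι × ℝ =>
          ENNReal.ofReal |a * deriv (c ω.1) ω.2 0 + b * deriv (c ω.1) ω.2 1| := by
        refine Measurable.ennreal_ofReal (continuous_abs.measurable.comp ?_)
        exact ((hdm 0).const_mul a).add ((hdm 1).const_mul b)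
      calc volume ((fun ω : ι × ℝ => a * c ω.1 ω.2 0 + b * c ω.1 ω.2 1) '' (S ∩ T))
          ≤ volume (⋃ i, (fun t => a * c i t 0 + b * c i t 1) '' K i) := by
            refine measure_mono ?_
            rintro _ ⟨ω, hω, rfl⟩
            exact mem_iUnion.2 ⟨ω.1, ω.2, hω, rfl⟩
        _ ≤ ∑' i, volume ((fun t => a * c i t 0 + b * c i t 1) '' K i) := measure_iUnion_le _
        _ ≤ ∑' i, ∫⁻ t in K i, ENNReal.ofReal |a * deriv (c i) t 0 + b * deriv (c i) t 1| := by
            refine ENNReal.tsum_le_tsum fun i => ?_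
            obtain ⟨C, hC⟩ := hg i
            refine (volume_image_le_lintegral_abs_deriv hC (hKm i)).trans (le_of_eq ?_)
            refine lintegral_congr_ae (ae_restrict_of_ae ?_)
            filter_upwards [hderiv i] with t ht
            rw [ht]
        _ = ∫⁻ ω in S ∩ T, ENNReal.ofReal
              |a * deriv (c ω.1) ω.2 0 + b * deriv (c ω.1) ω.2 1| ∂μ₀ := by
            rw [← lintegral_indicator (hcl.measurableSet.inter hT),
              hμ₀i _ (hG.indicator (hcl.measurableSet.inter hT))]
            refine tsum_congr fun i => ?_
            rw [← lintegral_indicator (hKm i)]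
            rfl
        _ = _ := by rw [Measure.restrict_restrict hT, inter_comm]
  · rw [Measure.restrict_apply_univ, ← lintegral_indicator_one hcl.measurableSet,
      hμ₀i _ (measurable_one.indicator hcl.measurableSet), totalLength]
    refine tsum_congr fun i => ?_
    have h1 : (fun t => S.indicator (1 : ι × ℝ → ℝ≥0∞) (i, t)) =
        (Icc 0 (curveLength (γ i)).toReal).indicator 1 := rfl
    rw [h1, lintegral_indicator_one measurableSet_Icc, Real.volume_Icc, sub_zero,
      ENNReal.ofReal_toReal (hγ.rectifiable i).ne]

/-- Every interior barrier for the unit square has length at least `2 + 10⁻⁵`. -/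
theorem theorem2 {ι : Type*} (γ : ι → C(I, Plane)) (hγ : IsInteriorBarrier unitSquare γ) :
    ENNReal.ofReal (2 + 1 / 10 ^ 5) ≤ totalLength γ := by
  have := hγ.countable
  let _ : TopologicalSpace ι := ⊥
  have : DiscreteTopology ι := ⟨rfl⟩
  let _ : MeasurableSpace ι := borel ι
  have : BorelSpace ι := ⟨rfl⟩
  obtain ⟨μ, S, x, y, u, v, h, hμ⟩ := exists_isSquareBarrierParam γ hγ
  have : IsFiniteMeasure μ := ⟨hμ ▸ hγ.totalLength_lt_top⟩
  rw [← hμ]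
  exact h.ofReal_le_measure_univ
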